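/- Let $S$ be the real discrete-time linear system $x_{k+1}=Ax_k+Bu_k$, $y_k=Cx_k+Du_k$ with $x_k\in\mathbb R^n$, $u_k\in\mathbb R^m$, $y_k\in\mathbb R^p$. Assume that $(A,C)$ is observable, $(A,B)$ is controllable, and that for some $L_0\le n$ the system has an $L_0$-delay left inverse, i.e. $u_k$ is uniquely determined by $x_k$ and $y_k,\dots,y_{k+L_0}$. Let $N\ge n$, $L\ge L_0$, $T\ge 0$, and let $u^d=(u^d_0,\dots,u^d_{T+N+L})$, $y^d=(y^d_0,\dots,y^d_{T+N+L})$ be a recorded input-output trajectory of $S$ such that $u^d$ is persistently exciting of order $n+N+L+1$, i.e. the block Hankel matrix of $u^d$ with $n+N+L+1$ block rows has full row rank. Let $U_p$ be the first $N$ block rows of the block Hankel matrix of $u^d$ with $N+L+1$ block rows and $T+1$ columns, $U_f$ its next block row, and $Y$ the block Hankel matrix of $y^d$ with $N+L+1$ block rows and $T+1$ columns. With ${}^\dagger$ the Moore–Penrose inverse and $\Pi=I-Y^\dagger Y$, put $$M_u=U_f\,\Pi\,(U_p\Pi)^\dagger,\qquad M_y=U_f\bigl(Y^\dagger-\Pi\,(U_p\Pi)^\dagger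 U_pY^\dagger\bigr).$$ Let $(u_k,y_k)_{k\ge 0}$ be any input-output trajectory of $S$. Given an initial guess $\hat u_0,\dots,\hat u_{N-1}\in\mathbb R^m$, define for $k\ge N$ $$\hat u_k=M_u\,\hat u_{k-N:k-1}+M_y\,y_{k-N:k+L},$$ where $w_{a:b}$ denotes the stacked vector of $w_a,\dots,w_b$. An invariant zero of $S$ is a $z\in\mathbb C$ with $\operatorname{rank}\begin{bmatrix}A-zI&B\\C&D\end{bmatrix}<n+m$; it is stable if $|z|<1$. Then: (i) If $S$ has no invariant zeros, then $M_u=0$, and for every initial guess $\hat u_k=u_k$ for all $k\ge N$ (that is, from the first iteration on). (ii) $\hat u_k-u_k\to0$ as $k\to\infty$ for every initial guess if and only if all invariant zeros of $S$ are stable. -/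

import Mathlib

open Filter Topology Matrix

noncomputable section

/-- `G` is the Moore–Penrose inverse of the real matrix `M`: the four Penrose equations. -/
structure IsMoorePenroseInverse {ι κ : Type*} [Fintype ι] [Fintype κ]
    (M : Matrix ι κ ℝ) (G : Matrix κ ι ℝ) : Prop where
  mul_mul_self : M * G * M = M
  mul_mul_inv : G * M * G = G
  symm_left : (M * G)ᵀ = M * G
  symm_right : (G * M)ᵀ = G * M

theorem IsMoorePenroseInverse.exists {ι κ : Type*} [Fintype ι] [Fintype κ]
    (M : Matrix ι κ ℝ) : ∃ G : Matrix κ ι ℝ, IsMoorePenroseInverse M G := by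
  classical
  -- a symmetric generalized inverse of the Gram matrix, by diagonalization
  obtain ⟨K, hKs, hHK, hHKH, hKHK⟩ : ∃ K : Matrix κ κ ℝ, Kᵀ = K ∧
      Mᵀ * M * K = K * (Mᵀ * M) ∧ Mᵀ * M * K * (Mᵀ * M) = Mᵀ * M ∧
      K * (Mᵀ * M) * K = K := by
    have hH : (Mᵀ * M).IsHermitian := by
      simpa using isHermitian_conjTranspose_mul_self M
    obtain ⟨V, d, hV, hVd⟩ : ∃ (V : Matrix κ κ ℝ) (d : κ → ℝ), Vᵀ * V = 1 ∧
        Mᵀ * M = V * diagonal d * Vᵀ := by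
      refine ⟨hH.eigenvectorUnitary, hH.eigenvalues, ?_, ?_⟩
      · simpa [star_eq_conjTranspose] using
          (Unitary.mem_iff.mp hH.eigenvectorUnitary.2).1
      · have := hH.spectral_theorem
        simpa [Unitary.conjStarAlgAut_apply, star_eq_conjTranspose, Function.comp_def]
          using this
    have key : ∀ a b : κ → ℝ, V * diagonal a * Vᵀ * (V * diagonal b * Vᵀ)
        = V * diagonal (fun i => a i * b i) * Vᵀ := by
      intro a b
      calc V * diagonal a * Vᵀ * (V * diagonal b * Vᵀ)
          = V * diagonal a * (Vᵀ * V) * diagonal b * Vᵀ := by simp only [Matrix.mul_assoc]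
        _ = _ := by rw [hV, Matrix.mul_one, Matrix.mul_assoc V, diagonal_mul_diagonal]
    refine ⟨V * diagonal (fun i => (d i)⁻¹) * Vᵀ, ?_, ?_, ?_, ?_⟩
    · simp [transpose_mul, Matrix.mul_assoc]
    · rw [hVd, key, key]
      simp only [mul_comm]
    · rw [hVd, key, key]
      simp only [mul_inv_mul_cancel]
    · rw [hVd, key, key]
      congr 3
      funext i
      by_cases h : d i = 0 <;> simp [h]
  refine ⟨K * Mᵀ, ?_, ?_, ?_, ?_⟩
  · have h : Mᵀ * M * (K * (Mᵀ * M) - 1) = 0 := by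
      rw [Matrix.mul_sub, ← Matrix.mul_assoc, hHKH, Matrix.mul_one, sub_self]
    have h2 : M * (K * (Mᵀ * M) - 1) = 0 := by
      have := (conjTranspose_mul_self_mul_eq_zero M (K * (Mᵀ * M) - 1)).mp (by simpa using h)
      exact this
    rw [Matrix.mul_sub, Matrix.mul_one, sub_eq_zero] at h2
    simpa only [Matrix.mul_assoc] using h2
  · calc K * Mᵀ * M * (K * Mᵀ) = K * (Mᵀ * M) * K * Mᵀ := by simp only [Matrix.mul_assoc]
      _ = K * Mᵀ := by rw [hKHK]
  · simp [transpose_mul, hKs, Matrix.mul_assoc]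
  · have : K * Mᵀ * M = K * (Mᵀ * M) := by rw [Matrix.mul_assoc]
    rw [this, transpose_mul, hKs, transpose_mul, transpose_transpose, hHK]

theorem IsMoorePenroseInverse.unique {ι κ : Type*} [Fintype ι] [Fintype κ]
    {M : Matrix ι κ ℝ} {G G' : Matrix κ ι ℝ}
    (h : IsMoorePenroseInverse M G) (h' : IsMoorePenroseInverse M G') : G = G' := by
  have e1 : M * G = M * G' := by
    calc M * G = (M * G)ᵀ := h.symm_left.symm
      _ = (M * G' * M * G)ᵀ := by rw [h'.mul_mul_self]
      _ = (M * G)ᵀ * (M * G')ᵀ := by rw [← transpose_mul, Matrix.mul_assoc (M * G')]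
      _ = M * G * M * G' := by rw [h.symm_left, h'.symm_left, ← Matrix.mul_assoc]
      _ = M * G' := by rw [h.mul_mul_self]
  have e2 : G * M = G' * M := by
    calc G * M = (G * M)ᵀ := h.symm_right.symm
      _ = (G * (M * G' * M))ᵀ := by rw [h'.mul_mul_self]
      _ = (G' * M)ᵀ * (G * M)ᵀ := by rw [← transpose_mul]; simp only [Matrix.mul_assoc]
      _ = G' * (M * G * M) := by rw [h.symm_right, h'.symm_right]; simp only [Matrix.mul_assoc]
      _ = G' * M := by rw [h.mul_mul_self]
  calc G = G * M * G := h.mul_mul_inv.symm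
    _ = G' * (M * G) := by rw [e2, Matrix.mul_assoc]
    _ = G' * M * G' := by rw [e1, Matrix.mul_assoc]
    _ = G' := h'.mul_mul_inv

/-- The Moore–Penrose inverse of a real matrix. -/
def pinv {ι κ : Type*} [Fintype ι] [Fintype κ] (M : Matrix ι κ ℝ) : Matrix κ ι ℝ :=
  (IsMoorePenroseInverse.exists M).choose

theorem pinv_spec {ι κ : Type*} [Fintype ι] [Fintype κ] (M : Matrix ι κ ℝ) :
    IsMoorePenroseInverse M (pinv M) :=
  (IsMoorePenroseInverse.exists M).choose_spec

/-- A discrete-time linear time-invariant system with `n` states, `m` inputs, `p` outputs. -/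
structure LTISystem (n m p : ℕ) where
  A : Matrix (Fin n) (Fin n) ℝ
  B : Matrix (Fin n) (Fin m) ℝ
  C : Matrix (Fin p) (Fin n) ℝ
  D : Matrix (Fin p) (Fin m) ℝ

namespace LTISystem

variable {n m p : ℕ}

/-- The signals `x`, `u`, `y` satisfy the state and output equations at time `k`:
`x (k+1) = A x_k + B u_k` and `y_k = C x_k + D u_k`. -/
def SatisfiedAt (S : LTISystem n m p) (x : ℕ → Fin n → ℝ) (u : ℕ → Fin m → ℝ)
    (y : ℕ → Fin p → ℝ) (k : ℕ) : Prop :=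
  x (k + 1) = S.A *ᵥ x k + S.B *ᵥ u k ∧ y k = S.C *ᵥ x k + S.D *ᵥ u k

/-- `(A, C)` is observable: the matrix with block rows `C, C A, …, C A ^ (n-1)` has rank `n`. -/
def IsObservable (S : LTISystem n m p) : Prop :=
  (Matrix.of fun (i : Fin n × Fin p) (j : Fin n) => (S.C * S.A ^ (i.1 : ℕ)) i.2 j).rank = n

/-- `(A, B)` is controllable: the matrix with block columns `B, A B, …, A ^ (n-1) B`
has rank `n`. -/
def IsControllable (S : LTISystem n m p) : Prop :=
  (Matrix.of fun (i : Fin n) (j : Fin n × Fin m) => (S.A ^ (j.1 : ℕ) * S.B) i j.2).rank = n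

/-- Existence of an `L`-delay left inverse: the input `u_0` is uniquely determined by the
initial state `x_0` and the outputs `y_0, …, y_L`. -/
def HasDelayLeftInverse (S : LTISystem n m p) (L : ℕ) : Prop :=
  ∀ (x x' : ℕ → Fin n → ℝ) (u u' : ℕ → Fin m → ℝ) (y y' : ℕ → Fin p → ℝ),
    (∀ k ≤ L, S.SatisfiedAt x u y k) → (∀ k ≤ L, S.SatisfiedAt x' u' y' k) →
    x 0 = x' 0 → (∀ k ≤ L, y k = y' k) → u 0 = u' 0

/-- `z` is an invariant zero: the system matrix `[A - z I, B; C, D]` has rank less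
than `n + m`. -/
def IsInvariantZero (S : LTISystem n m p) (z : ℂ) : Prop :=
  (Matrix.fromBlocks (S.A.map Complex.ofReal - z • (1 : Matrix (Fin n) (Fin n) ℂ))
    (S.B.map Complex.ofReal) (S.C.map Complex.ofReal) (S.D.map Complex.ofReal)).rank < n + m

end LTISystem

/-- The block Hankel matrix with `t` block rows and `c` columns of the signal `w`:
block `(i, j)` is `w (i + j)`. It involves the samples `w 0, …, w (t + c - 2)` only. -/
def hankel {q : ℕ} (t c : ℕ) (w : ℕ → Fin q → ℝ) : Matrix (Fin t × Fin q) (Fin c) ℝ :=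
  Matrix.of fun i j => w ((i.1 : ℕ) + (j : ℕ)) i.2

/-- The signal `w 0, …, w (ℓ - 1)` of length `ℓ` is persistently exciting of order `t`: its
Hankel matrix with `t` block rows, which has `ℓ + 1 - t` columns, has full row rank. -/
def PersistentlyExciting {q : ℕ} (ℓ t : ℕ) (w : ℕ → Fin q → ℝ) : Prop :=
  (hankel t (ℓ + 1 - t) w).rank = t * q

/-- The stacked vector of `w k, …, w (k + t - 1)`. -/
def stack {q : ℕ} (t : ℕ) (w : ℕ → Fin q → ℝ) (k : ℕ) : Fin t × Fin q → ℝ :=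
  fun i => w (k + (i.1 : ℕ)) i.2

section Estimator

variable {m p : ℕ}

/-- `U_p`: the first `N` block rows of the input Hankel matrix of depth `N + L + 1`. -/
def dataUp (N T : ℕ) (ud : ℕ → Fin m → ℝ) : Matrix (Fin N × Fin m) (Fin (T + 1)) ℝ :=
  hankel N (T + 1) ud

/-- `U_f`: the block row with index `N` of the input Hankel matrix of depth `N + L + 1`. -/
def dataUf (N T : ℕ) (ud : ℕ → Fin m → ℝ) : Matrix (Fin m) (Fin (T + 1)) ℝ :=
  Matrix.of fun i j => ud (N + (j : ℕ)) i

/-- `Y`: the output Hankel matrix of depth `N + L + 1`. -/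
def dataY (N L T : ℕ) (yd : ℕ → Fin p → ℝ) :
    Matrix (Fin (N + L + 1) × Fin p) (Fin (T + 1)) ℝ :=
  hankel (N + L + 1) (T + 1) yd

/-- `I - Y† Y`, the orthogonal projector onto the kernel of `Y`. -/
def projY (N L T : ℕ) (yd : ℕ → Fin p → ℝ) : Matrix (Fin (T + 1)) (Fin (T + 1)) ℝ :=
  1 - pinv (dataY N L T yd) * dataY N L T yd

/-- `M_u = U_f Π (U_p Π)†` with `Π = I - Y† Y`. -/
def gainU (N L T : ℕ) (ud : ℕ → Fin m → ℝ) (yd : ℕ → Fin p → ℝ) :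
    Matrix (Fin m) (Fin N × Fin m) ℝ :=
  dataUf N T ud * projY N L T yd * pinv (dataUp N T ud * projY N L T yd)

/-- `M_y = U_f (Y† - Π (U_p Π)† U_p Y†)` with `Π = I - Y† Y`. -/
def gainY (N L T : ℕ) (ud : ℕ → Fin m → ℝ) (yd : ℕ → Fin p → ℝ) :
    Matrix (Fin m) (Fin (N + L + 1) × Fin p) ℝ :=
  dataUf N T ud * (pinv (dataY N L T yd) -
    projY N L T yd * pinv (dataUp N T ud * projY N L T yd) * dataUp N T ud *
      pinv (dataY N L T yd))

/-- The data-driven input estimate `û`, from offline data `ud`, `yd`, online outputs `y` and an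
arbitrary initial guess `g` for `û_0, …, û_{N-1}`: for `k ≥ N`,
`û_k = M_u û_{k-N:k-1} + M_y y_{k-N:k+L}`. -/
def estimate (N L T : ℕ) (ud : ℕ → Fin m → ℝ) (yd : ℕ → Fin p → ℝ) (y : ℕ → Fin p → ℝ)
    (g : Fin N → Fin m → ℝ) (k : ℕ) : Fin m → ℝ :=
  if h : k < N then g ⟨k, h⟩
  else
    gainU N L T ud yd *ᵥ
        (fun i : Fin N × Fin m => estimate N L T ud yd y g (k - N + (i.1 : ℕ)) i.2) +
      gainY N L T ud yd *ᵥ stack (N + L + 1) y (k - N)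
  termination_by k
  decreasing_by have := i.1.2; omega

theorem estimate_of_lt (N L T : ℕ) (ud : ℕ → Fin m → ℝ) (yd y : ℕ → Fin p → ℝ)
    (g : Fin N → Fin m → ℝ) (i : Fin N) : estimate N L T ud yd y g i = g i := by
  rw [estimate, dif_pos i.2]

theorem estimate_add (N L T : ℕ) (ud : ℕ → Fin m → ℝ) (yd y : ℕ → Fin p → ℝ)
    (g : Fin N → Fin m → ℝ) (k : ℕ) :
    estimate N L T ud yd y g (k + N) =
      gainU N L T ud yd *ᵥ stack N (estimate N L T ud yd y g) k +
        gainY N L T ud yd *ᵥ stack (N + L + 1) y k := by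
  rw [estimate, dif_neg (by omega)]
  simp only [Nat.add_sub_cancel]
  rfl

end Estimator

end

/-! Put W = U_p Π and let R be the range of W. Controllability and persistent excitation make the
recorded data span all trajectory windows of length N+L+1 (`exists_combination`), so R consists of
the first N inputs of zero-output windows. Observability over the past and the left inverse at time
N give ker Y ∩ ker U_p ⊆ ker U_f (`dataUf_mulVec_eq_zero`), hence M_u U_p + M_y Y = U_f. The
estimator is therefore exact on trajectories, and the error iterates the block companion map Φ of
M_u.

On R, Φ is the true time shift. It preserves R: the zero-output subspaces stabilise after n steps,
so a shifted window can be prolonged to full length, and the left inverse keeps its first N inputs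
(`exists_shift_eq`). An eigenvector in R has a geometric input, by observability also a geometric
state, and so is a zero direction. Without zeros, R has no eigenvector, so R = 0 and M_u = 0.

In general M_u = M_u W W†, so the component r of an eigenvector orthogonal to R sees only the
nilpotent shift compressed to the complement of R. A norm comparison forces r = 0 when |z| ≥ 1
(`eq_zero_of_compressed_shift_eigenvector`). Hence eigenvalues of Φ with |z| ≥ 1 are invariant
zeros, and stable zeros give spectral radius below 1. Conversely, a zero direction with |z| ≥ 1
yields an input that can be added to u without changing y; initialised with the sum, the estimator
reproduces it and the error does not decay. -/

noncomputable section

/-! ### Rank criteria and decay of operator powers. -/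

section LinearAlgebra

variable {ι κ K : Type*} [Fintype κ] [Field K]

theorem Matrix.eq_zero_of_mulVec_eq_zero_of_rank_eq {M : Matrix ι κ K}
    (hM : M.rank = Fintype.card κ) {v : κ → K} (hv : M *ᵥ v = 0) : v = 0 := by
  have h := LinearMap.finrank_range_add_finrank_ker M.mulVecLin
  rw [Module.finrank_fintype_fun_eq_card] at h
  have hk : Module.finrank K (LinearMap.ker M.mulVecLin) = 0 := by
    have : M.rank = Module.finrank K (LinearMap.range M.mulVecLin) := rfl
    omega
  have hb : LinearMap.ker M.mulVecLin = ⊥ := Submodule.finrank_eq_zero.mp hk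
  have : v ∈ LinearMap.ker M.mulVecLin := by simpa using hv
  rw [hb] at this
  simpa using this

theorem Matrix.rank_lt_card_iff_exists_mulVec_eq_zero {M : Matrix ι κ K} :
    M.rank < Fintype.card κ ↔ ∃ v ≠ 0, M *ᵥ v = 0 := by
  constructor
  · intro h
    by_contra! hc
    have hk : LinearMap.ker M.mulVecLin = ⊥ := by
      rw [LinearMap.ker_eq_bot']
      intro v hv
      by_contra hne
      exact hc v hne (by simpa using hv)
    have h2 := LinearMap.finrank_range_add_finrank_ker M.mulVecLin
    rw [Module.finrank_fintype_fun_eq_card, hk, finrank_bot] at h2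
    have : M.rank = Module.finrank K (LinearMap.range M.mulVecLin) := rfl
    omega
  · rintro ⟨v, hv, h⟩
    refine lt_of_le_of_ne M.rank_le_card_width fun he => hv ?_
    exact eq_zero_of_mulVec_eq_zero_of_rank_eq he h

theorem Matrix.eq_zero_of_vecMul_eq_zero_of_rank_eq [Fintype ι] {M : Matrix ι κ K}
    (hM : M.rank = Fintype.card ι) {v : ι → K} (hv : v ᵥ* M = 0) : v = 0 :=
  eq_zero_of_mulVec_eq_zero_of_rank_eq (M := Mᵀ) (by rw [rank_transpose, hM])
    (by rw [mulVec_transpose, hv])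

theorem Matrix.exists_mulVec_eq_of_vecMul_injective [Fintype ι] {M : Matrix ι κ K}
    (hM : ∀ v, v ᵥ* M = 0 → v = 0) (b : ι → K) : ∃ v, M *ᵥ v = b := by
  have h1 : ¬ Mᵀ.rank < Fintype.card ι := by
    rw [rank_lt_card_iff_exists_mulVec_eq_zero]
    rintro ⟨v, hv, h⟩
    exact hv (hM v (by rwa [mulVec_transpose] at h))
  have h2 : Module.finrank K (LinearMap.range M.mulVecLin) = Module.finrank K (ι → K) := by
    rw [Module.finrank_fintype_fun_eq_card]
    have := M.rank_le_card_height
    rw [rank_transpose] at h1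
    have h3 : M.rank = Module.finrank K (LinearMap.range M.mulVecLin) := rfl
    omega
  have h3 : b ∈ LinearMap.range M.mulVecLin := by
    rw [Submodule.eq_top_of_finrank_eq h2]; trivial
  obtain ⟨v, hv⟩ := h3
  exact ⟨v, by simpa using hv⟩

/-- The powers of an operator with spectrum in the open unit disc tend to zero. -/
theorem Module.End.tendsto_pow_apply_of_hasEigenvalue_norm_lt_one {E : Type*}
    [NormedAddCommGroup E] [NormedSpace ℂ E] [FiniteDimensional ℂ E] (f : Module.End ℂ E)
    (hf : ∀ z, f.HasEigenvalue z → ‖z‖ < 1) (v : E) :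
    Tendsto (fun k : ℕ => (f ^ k) v) atTop (𝓝 0) := by
  rcases subsingleton_or_nontrivial E with hE | hE
  · simp [Subsingleton.elim _ (0 : E)]
  have : CompleteSpace E := FiniteDimensional.complete ℂ E
  set a : E →L[ℂ] E := Module.End.toContinuousLinearMap E f with ha
  have hρ : spectralRadius ℂ a < (1 : NNReal) := by
    refine spectrum.spectralRadius_lt_of_forall_lt a fun z hz => ?_
    rw [ha, AlgEquiv.spectrum_eq, ← Module.End.hasEigenvalue_iff_mem_spectrum] at hz
    exact_mod_cast hf z hz
  obtain ⟨r, hr1, hr2⟩ := ENNReal.lt_iff_exists_nnreal_btwn.mp hρ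
  have hr2' : r < 1 := by exact_mod_cast hr2
  -- Gelfand's formula, with r strictly between the spectral radius and 1.
  have hev : ∀ᶠ k : ℕ in atTop, ‖a ^ k‖ ≤ (r : ℝ) ^ k := by
    filter_upwards [(spectrum.pow_nnnorm_pow_one_div_tendsto_nhds_spectralRadius a).eventually
      (gt_mem_nhds hr1), eventually_gt_atTop 0] with k hk hk0
    have hk1 : (0 : ℝ) < k := by exact_mod_cast hk0
    have h1 := ENNReal.rpow_le_rpow hk.le hk1.le
    rw [← ENNReal.rpow_mul, one_div_mul_cancel hk1.ne', ENNReal.rpow_one,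
      ENNReal.rpow_natCast] at h1
    have h2 : ‖a ^ k‖₊ ≤ r ^ k := by exact_mod_cast h1
    exact_mod_cast h2
  have hpow : Tendsto (fun k : ℕ => (r : ℝ) ^ k * ‖v‖) atTop (𝓝 0) := by
    have := (tendsto_pow_atTop_nhds_zero_of_lt_one r.2 (by exact_mod_cast hr2')).mul_const ‖v‖
    simpa using this
  refine squeeze_zero_norm' ?_ hpow
  filter_upwards [hev] with k hk
  have h1 : (f ^ k) v = (a ^ k) v := by
    rw [ha, ← map_pow]; rfl
  rw [h1]
  exact ((a ^ k).le_opNorm v).trans (by gcongr)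

end LinearAlgebra

/-! ### Persistent excitation and the joint rank of states and input windows. -/

namespace LTISystem

variable {n m p : ℕ}

theorem IsObservable.eq_zero {S : LTISystem n m p} (hS : S.IsObservable) {x : Fin n → ℝ}
    (hx : ∀ k < n, (S.C * S.A ^ k) *ᵥ x = 0) : x = 0 := by
  refine eq_zero_of_mulVec_eq_zero_of_rank_eq (hS.trans (Fintype.card_fin n).symm) ?_
  ext ⟨i, j⟩
  exact congrFun (hx i i.2) j

theorem IsControllable.eq_zero {S : LTISystem n m p} (hS : S.IsControllable) {ξ : Fin n → ℝ}
    (hξ : ∀ k < n, ξ ᵥ* (S.A ^ k * S.B) = 0) : ξ = 0 := by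
  refine eq_zero_of_vecMul_eq_zero_of_rank_eq (hS.trans (Fintype.card_fin n).symm) ?_
  ext ⟨i, j⟩
  exact congrFun (hξ i i.2) j

/-- Prolonging an annihilator `(ξ, η)` of the state and the input windows by `j` steps back
in time: the coefficients of the input window after `j` uses of the state equation. -/
def annihilator (S : LTISystem n m p) (ξ : Fin n → ℝ) (η : ℕ → Fin m → ℝ) :
    ℕ → ℕ → Fin m → ℝ
  | 0, s => η s
  | j + 1, 0 => ξ ᵥ* (S.A ^ j * S.B)
  | j + 1, s + 1 => annihilator S ξ η j s

theorem annihilator_add (S : LTISystem n m p) (ξ : Fin n → ℝ) (η : ℕ → Fin m → ℝ) (j s : ℕ) :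
    S.annihilator ξ η j (j + s) = η s := by
  induction j with
  | zero => simp [annihilator]
  | succ j ih => rw [show j + 1 + s = (j + s) + 1 by omega, annihilator, ih]

theorem annihilator_of_lt (S : LTISystem n m p) (ξ : Fin n → ℝ) (η : ℕ → Fin m → ℝ) (s k : ℕ) :
    S.annihilator ξ η (s + 1 + k) s = ξ ᵥ* (S.A ^ k * S.B) := by
  induction s with
  | zero => rw [show 0 + 1 + k = k + 1 by omega, annihilator]
  | succ s ih => rw [show s + 1 + 1 + k = (s + 1 + k) + 1 by omega, annihilator, ih]

/-- Each step applies the relation at time `i + 1` and substitutes the state equation for `x (i +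
1)`; the term in B becomes the new coefficient of `u i`. -/
theorem annihilator_sum {S : LTISystem n m p} {T t : ℕ} {x : ℕ → Fin n → ℝ}
    {u : ℕ → Fin m → ℝ} {y : ℕ → Fin p → ℝ} (hd : ∀ k < T + t, S.SatisfiedAt x u y k)
    (ht : 0 < t) {ξ : Fin n → ℝ} {η : ℕ → Fin m → ℝ}
    (h : ∀ i ≤ T, ξ ⬝ᵥ x i + ∑ s ∈ Finset.range t, η s ⬝ᵥ u (i + s) = 0) (j : ℕ) :
    ∀ i, i + j ≤ T → (ξ ᵥ* S.A ^ j) ⬝ᵥ x i +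
      ∑ s ∈ Finset.range (t + j), S.annihilator ξ η j s ⬝ᵥ u (i + s) = 0 := by
  induction j with
  | zero => intro i hi; simpa [annihilator] using h i hi
  | succ j ih =>
    intro i hi
    have h1 := ih (i + 1) (by omega)
    rw [(hd i (by omega)).1] at h1
    rw [← add_assoc t j 1, Finset.sum_range_succ']
    simp only [annihilator]
    rw [← h1, dotProduct_add, pow_succ, ← vecMul_vecMul, ← vecMul_vecMul,
      dotProduct_mulVec, dotProduct_mulVec, add_zero]
    simp only [add_assoc, add_comm 1]
    congr 1
    rw [add_comm]

/-- A persistently exciting input of a controllable system makes the state and the input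
windows jointly of full row rank. -/
theorem eq_zero_of_annihilates {S : LTISystem n m p} (hctr : S.IsControllable) {T t : ℕ}
    (ht : 0 < t) {x : ℕ → Fin n → ℝ} {u : ℕ → Fin m → ℝ} {y : ℕ → Fin p → ℝ}
    (hd : ∀ k < T + t, S.SatisfiedAt x u y k) (hPE : PersistentlyExciting (T + t) (n + t) u)
    {ξ : Fin n → ℝ} {η : ℕ → Fin m → ℝ} (hη : ∀ s, t ≤ s → η s = 0)
    (h : ∀ i ≤ T, ξ ⬝ᵥ x i + ∑ s ∈ Finset.range t, η s ⬝ᵥ u (i + s) = 0) :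
    ξ = 0 ∧ η = 0 := by
  set v := S.annihilator ξ η with hv
  set a := S.A.charpoly.coeff with ha
  have hdeg : S.A.charpoly.natDegree = n := by simp [charpoly_natDegree_eq_dim]
  have han : a n = 1 := by
    have := S.A.charpoly_monic.coeff_natDegree
    rwa [hdeg] at this
  have hsupp : ∀ j ≤ n, ∀ s, t + j ≤ s → v j s = 0 := by
    intro j _ s hs
    obtain ⟨r, rfl⟩ := Nat.exists_eq_add_of_le (show j ≤ s by omega)
    rw [hv, annihilator_add, hη _ (by omega)]
  have hsum : ∀ i, i + n ≤ T → ∑ s ∈ Finset.range (n + t),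
      (∑ j ∈ Finset.range (n + 1), a j • v j s) ⬝ᵥ u (i + s) = 0 := by
    intro i hi
    -- Cayley–Hamilton: weighting the prolonged relations by the characteristic coefficients
    -- eliminates the state and leaves a relation among inputs alone.
    have hCH : ∑ j ∈ Finset.range (n + 1), a j • (ξ ᵥ* S.A ^ j) = 0 := by
      have := S.A.aeval_self_charpoly
      rw [Polynomial.aeval_eq_sum_range, hdeg] at this
      have h2 := congrArg (fun M => ξ ᵥ* M) this
      simpa [Matrix.vecMul_sum, vecMul_smul] using h2
    have h1 : ∑ j ∈ Finset.range (n + 1), a j * ((ξ ᵥ* S.A ^ j) ⬝ᵥ x i +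
        ∑ s ∈ Finset.range (n + t), v j s ⬝ᵥ u (i + s)) = 0 := by
      refine Finset.sum_eq_zero fun j hj => ?_
      have hj' : j ≤ n := by simpa [Nat.lt_succ_iff] using hj
      have h2 := annihilator_sum hd ht h j i (by omega)
      rw [← Finset.sum_subset (Finset.range_mono (show t + j ≤ n + t by omega)), h2, mul_zero]
      intro s _ hs
      rw [hsupp j hj' s (by simpa using hs), zero_dotProduct]
    simp only [mul_add, Finset.sum_add_distrib, Finset.mul_sum] at h1
    rw [Finset.sum_comm (s := Finset.range (n + 1))] at h1
    simp only [sum_dotProduct, smul_dotProduct, smul_eq_mul]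
    have h3 : ∑ j ∈ Finset.range (n + 1), a j * ((ξ ᵥ* S.A ^ j) ⬝ᵥ x i) = 0 := by
      have := congrArg (· ⬝ᵥ x i) hCH
      simpa [sum_dotProduct] using this
    rw [h3, zero_add] at h1
    exact h1
  have hzero : ∀ s < n + t, ∑ j ∈ Finset.range (n + 1), a j • v j s = 0 := by
    have h1 : (fun is : Fin (n + t) × Fin m =>
        (∑ j ∈ Finset.range (n + 1), a j • v j is.1) is.2) = 0 := by
      refine eq_zero_of_vecMul_eq_zero_of_rank_eq (M := hankel (n + t) (T + t + 1 - (n + t)) u)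
        ?_ ?_
      · rw [Fintype.card_prod, Fintype.card_fin, Fintype.card_fin]; exact hPE
      · ext i
        have := hsum i (by have := i.2; omega)
        rw [Finset.sum_range] at this
        simp only [Pi.zero_apply]
        rw [← this]
        simp only [vecMul, dotProduct, Fintype.sum_prod_type, hankel, of_apply, add_comm]
    intro s hs
    ext b
    exact congrFun h1 (⟨s, hs⟩, b)
  -- Downward induction on s. At index `n + s` the term `j = n` is `η s` with coefficient 1, while
  -- each `j < n` contributes a later value of η.
  have hη0 : ∀ d s, t ≤ s + d → η s = 0 := by
    intro d
    induction d with
    | zero => intro s hs; exact hη s hs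
    | succ d ih =>
      intro s hs
      by_cases hst : t ≤ s
      · exact hη s hst
      have h1 := hzero (n + s) (by omega)
      rw [Finset.sum_range_succ, Finset.sum_eq_zero, zero_add, hv, annihilator_add, han,
        one_smul] at h1
      · exact h1
      · intro j hj
        have hj' : j < n := by simpa using hj
        rw [show n + s = j + (n - j + s) by omega, hv, annihilator_add, ih _ (by omega),
          smul_zero]
  have hη1 : η = 0 := by
    funext s
    exact hη0 t s (by omega)
  refine ⟨hctr.eq_zero fun k => ?_, hη1⟩
  induction k using Nat.strong_induction_on with
  | _ k ih =>
    intro hk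
    -- At index `n - 1 - k` the term `j = n` is ξ A^k B; the other terms are values of η or ξ A^i B
    -- with i < k, all zero already.
    have h1 := hzero (n - 1 - k) (by omega)
    rw [Finset.sum_eq_single n, han, one_smul] at h1
    · have h2 := S.annihilator_of_lt ξ η (n - 1 - k) k
      rw [show n - 1 - k + 1 + k = n by omega] at h2
      rw [← h2, ← hv, h1]
    · intro j hj hjn
      have hj' : j ≤ n := by simpa [Nat.lt_succ_iff] using hj
      by_cases hjk : j ≤ n - 1 - k
      · rw [show n - 1 - k = j + (n - 1 - k - j) by omega, hv, annihilator_add, hη1]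
        simp
      · rw [hv, show j = n - 1 - k + 1 + (j - (n - 1 - k + 1)) by omega, annihilator_of_lt,
          ih _ (by omega) (by omega), smul_zero]
    · simp

end LTISystem

/-- The block row with index `i` and `c` columns of a Hankel matrix of the signal `w`. -/
def blockRow {q : ℕ} (c i : ℕ) (w : ℕ → Fin q → ℝ) : Matrix (Fin q) (Fin c) ℝ :=
  Matrix.of fun a j => w (i + (j : ℕ)) a

theorem hankel_mulVec_eq_zero_iff {q t c : ℕ} {w : ℕ → Fin q → ℝ} {g : Fin c → ℝ} :
    hankel t c w *ᵥ g = 0 ↔ ∀ i < t, blockRow c i w *ᵥ g = 0 := by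
  constructor
  · intro h i hi
    ext a
    exact congrFun h (⟨i, hi⟩, a)
  · intro h
    ext ⟨i, a⟩
    exact congrFun (h i i.2) a

theorem hankel_mulVec_eq_stack {q t c : ℕ} {w v : ℕ → Fin q → ℝ} {g : Fin c → ℝ}
    {k : ℕ} (h : ∀ i < t, blockRow c i w *ᵥ g = v (k + i)) : hankel t c w *ᵥ g = stack t v k := by
  ext ⟨i, a⟩
  exact congrFun (h i i.2) a

/-! ### Uniqueness of trajectories and zero-output subspaces. -/

namespace LTISystem

variable {n m p : ℕ} {S : LTISystem n m p}

theorem SatisfiedAt.shift {x : ℕ → Fin n → ℝ} {u : ℕ → Fin m → ℝ} {y : ℕ → Fin p → ℝ} {k i : ℕ}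
    (h : S.SatisfiedAt x u y (k + i)) :
    S.SatisfiedAt (fun j => x (k + j)) (fun j => u (k + j)) (fun j => y (k + j)) i := h

theorem SatisfiedAt.zero (i : ℕ) : S.SatisfiedAt 0 0 0 i := by
  simp [SatisfiedAt]

theorem SatisfiedAt.add {x x' : ℕ → Fin n → ℝ} {u u' : ℕ → Fin m → ℝ} {y y' : ℕ → Fin p → ℝ}
    {k : ℕ} (h : S.SatisfiedAt x u y k) (h' : S.SatisfiedAt x' u' y' k) :
    S.SatisfiedAt (x + x') (u + u') (y + y') k := by
  obtain ⟨h1, h2⟩ := h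
  obtain ⟨h3, h4⟩ := h'
  constructor
  · simp only [Pi.add_apply, h1, h3, mulVec_add]; abel
  · simp only [Pi.add_apply, h2, h4, mulVec_add]; abel

/-- With equal inputs, the difference of the states evolves freely and has zero output, so
observability applies. -/
theorem eq_of_output_eq {x x' : ℕ → Fin n → ℝ} {u : ℕ → Fin m → ℝ} {y : ℕ → Fin p → ℝ} {t : ℕ}
    (h : ∀ k < t, S.SatisfiedAt x u y k) (h' : ∀ k < t, S.SatisfiedAt x' u y k) (ht : n ≤ t)
    (hobs : S.IsObservable) : x 0 = x' 0 := by
  have hk : ∀ k ≤ t, x k - x' k = S.A ^ k *ᵥ (x 0 - x' 0) := by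
    intro k
    induction k with
    | zero => simp
    | succ k ih =>
      intro hk
      rw [(h k hk).1, (h' k hk).1, add_sub_add_right_eq_sub, ← mulVec_sub, ih (by omega),
        mulVec_mulVec, pow_succ']
  rw [← sub_eq_zero]
  refine hobs.eq_zero fun k hkn => ?_
  rw [← mulVec_mulVec, ← hk k (by omega), mulVec_sub, sub_eq_zero]
  have h1 := (h k (by omega)).2
  rw [(h' k (by omega)).2] at h1
  exact (add_right_cancel h1).symm

theorem state_eq_zero_of_input_eq_zero {x : ℕ → Fin n → ℝ} {u : ℕ → Fin m → ℝ}
    {y : ℕ → Fin p → ℝ} {t : ℕ} (h : ∀ k < t, S.SatisfiedAt x u y k)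
    (hu : ∀ k < t, u k = 0) (hx : x 0 = 0) : ∀ k ≤ t, x k = 0 := by
  intro k
  induction k with
  | zero => intro _; exact hx
  | succ k ih => intro hk; rw [(h k hk).1, hu k hk, ih (by omega)]; simp

/-- A delayed left inverse determines the state and the input up to the delay. -/
theorem HasDelayLeftInverse.eq_of_output_eq {L₀ : ℕ} (hinv : S.HasDelayLeftInverse L₀)
    {x x' : ℕ → Fin n → ℝ} {u u' : ℕ → Fin m → ℝ} {y : ℕ → Fin p → ℝ} {t : ℕ}
    (h : ∀ k < t, S.SatisfiedAt x u y k) (h' : ∀ k < t, S.SatisfiedAt x' u' y k)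
    (hx : x 0 = x' 0) : ∀ i, i + L₀ < t → x i = x' i ∧ u i = u' i := by
  have key : ∀ i, i + L₀ < t → x i = x' i → u i = u' i := by
    intro i hi hxi
    exact hinv (fun j => x (i + j)) (fun j => x' (i + j)) (fun j => u (i + j))
      (fun j => u' (i + j)) (fun j => y (i + j)) (fun j => y (i + j))
      (fun k hk => (h _ (by omega)).shift) (fun k hk => (h' _ (by omega)).shift) hxi
      (fun _ _ => rfl)
  intro i
  induction i with
  | zero => intro hi; exact ⟨hx, key 0 hi hx⟩
  | succ i ih =>
    intro hi
    obtain ⟨h1, h2⟩ := ih (by omega)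
    have h3 : x (i + 1) = x' (i + 1) := by
      rw [(h i (by omega)).1, (h' i (by omega)).1, h1, h2]
    exact ⟨h3, key _ hi h3⟩

/-- The states from which one input keeps the output zero and reaches `V`. -/
def zeroOutputPreimage (S : LTISystem n m p) (V : Submodule ℝ (Fin n → ℝ)) :
    Submodule ℝ (Fin n → ℝ) where
  carrier := {x | ∃ u, S.C *ᵥ x + S.D *ᵥ u = 0 ∧ S.A *ᵥ x + S.B *ᵥ u ∈ V}
  zero_mem' := ⟨0, by simp, by simp⟩
  add_mem' := by
    rintro x x' ⟨u, h1, h2⟩ ⟨u', h3, h4⟩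
    refine ⟨u + u', ?_, ?_⟩
    · rw [mulVec_add, mulVec_add, add_add_add_comm, h1, h3, add_zero]
    · rw [mulVec_add, mulVec_add, add_add_add_comm]; exact V.add_mem h2 h4
  smul_mem' := by
    rintro c x ⟨u, h1, h2⟩
    refine ⟨c • u, ?_, ?_⟩
    · rw [mulVec_smul, mulVec_smul, ← smul_add, h1, smul_zero]
    · rw [mulVec_smul, mulVec_smul, ← smul_add]; exact V.smul_mem c h2

theorem zeroOutputPreimage_mono (S : LTISystem n m p) : Monotone S.zeroOutputPreimage := by
  rintro V W hVW x ⟨u, h1, h2⟩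
  exact ⟨u, h1, hVW h2⟩

/-- The states from which some input keeps the output zero for `k` steps. -/
def zeroOutputStates (S : LTISystem n m p) (k : ℕ) : Submodule ℝ (Fin n → ℝ) :=
  S.zeroOutputPreimage^[k] ⊤

theorem zeroOutputStates_succ (S : LTISystem n m p) (k : ℕ) :
    S.zeroOutputStates (k + 1) = S.zeroOutputPreimage (S.zeroOutputStates k) :=
  Function.iterate_succ_apply' _ _ _

theorem zeroOutputStates_succ_le (S : LTISystem n m p) (k : ℕ) :
    S.zeroOutputStates (k + 1) ≤ S.zeroOutputStates k := by
  induction k with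
  | zero => exact le_top
  | succ k ih =>
    rw [S.zeroOutputStates_succ (k + 1)]
    conv_rhs => rw [S.zeroOutputStates_succ k]
    exact S.zeroOutputPreimage_mono ih

/-- A decreasing chain in dimension n cannot drop n + 1 times, and being iterates of one map it
stays constant once two consecutive terms agree. -/
theorem zeroOutputStates_succ_eq (S : LTISystem n m p) {k : ℕ} (hk : n ≤ k) :
    S.zeroOutputStates (k + 1) = S.zeroOutputStates k := by
  obtain ⟨i, hi, h⟩ : ∃ i ≤ n, S.zeroOutputStates (i + 1) = S.zeroOutputStates i := by
    by_contra! hc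
    have hdim : ∀ i ≤ n + 1, Module.finrank ℝ (S.zeroOutputStates i) + i ≤ n := by
      intro i
      induction i with
      | zero => intro _; simpa using (S.zeroOutputStates 0).finrank_le
      | succ i ih =>
        intro hi
        have := Submodule.finrank_lt_finrank_of_lt
          (lt_of_le_of_ne (S.zeroOutputStates_succ_le i) (hc i (by omega)))
        have := ih (by omega)
        omega
    have := hdim (n + 1) le_rfl
    omega
  have hstep : ∀ d, S.zeroOutputStates (i + d + 1) = S.zeroOutputStates (i + d) := by
    intro d
    induction d with
    | zero => exact h
    | succ d ih =>
      rw [S.zeroOutputStates_succ (i + (d + 1)), ← add_assoc, ih, ← S.zeroOutputStates_succ, ih]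
  obtain ⟨d, rfl⟩ := Nat.exists_eq_add_of_le (hi.trans hk)
  exact hstep d

theorem mem_zeroOutputStates_iff {k : ℕ} {x₀ : Fin n → ℝ} :
    x₀ ∈ S.zeroOutputStates k ↔ ∃ (x : ℕ → Fin n → ℝ) (u : ℕ → Fin m → ℝ),
      x 0 = x₀ ∧ ∀ i < k, S.SatisfiedAt x u 0 i := by
  induction k generalizing x₀ with
  | zero => simp only [not_lt_zero, IsEmpty.forall_iff, implies_true, and_true, exists_const]
            exact ⟨fun _ => ⟨fun _ => x₀, rfl⟩, fun _ => trivial⟩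
  | succ k ih =>
    rw [zeroOutputStates_succ]
    constructor
    · rintro ⟨u₀, h1, h2⟩
      obtain ⟨x, u, hx, hs⟩ := ih.mp h2
      refine ⟨fun i => Nat.casesOn i x₀ x, fun i => Nat.casesOn i u₀ u, rfl, ?_⟩
      rintro (_ | i) hi
      · exact ⟨hx, h1.symm⟩
      · exact hs i (by omega)
    · rintro ⟨x, u, rfl, hs⟩
      refine ⟨u 0, (hs 0 (by omega)).2.symm, ?_⟩
      rw [← (hs 0 (by omega)).1]
      refine ih.mpr ⟨fun i => x (1 + i), fun i => u (1 + i), rfl, fun i hi => ?_⟩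
      exact (hs (1 + i) (by omega)).shift

/-- A zero-output trajectory over `t ≥ n` steps may be replaced by one over `t + 1` steps
with the same initial state. -/
theorem exists_zeroOutput_extension {x : ℕ → Fin n → ℝ} {u : ℕ → Fin m → ℝ} {t : ℕ} (ht : n ≤ t)
    (h : ∀ i < t, S.SatisfiedAt x u 0 i) : ∃ (x' : ℕ → Fin n → ℝ) (u' : ℕ → Fin m → ℝ),
      x' 0 = x 0 ∧ ∀ i < t + 1, S.SatisfiedAt x' u' 0 i := by
  rw [← mem_zeroOutputStates_iff, S.zeroOutputStates_succ_eq ht, mem_zeroOutputStates_iff]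
  exact ⟨x, u, rfl, h⟩

/-- The standing assumptions: an observable and controllable system with an `L₀`-delay left
inverse, and a recorded trajectory with persistently exciting input. -/
structure IsExcitingRecord (S : LTISystem n m p) (L₀ N L T : ℕ) (xd : ℕ → Fin n → ℝ)
    (ud : ℕ → Fin m → ℝ) (yd : ℕ → Fin p → ℝ) : Prop where
  obs : S.IsObservable
  ctr : S.IsControllable
  inv : S.HasDelayLeftInverse L₀
  le_past : n ≤ N
  le_delay : L₀ ≤ L
  satisfied : ∀ k < T + (N + L + 1), S.SatisfiedAt xd ud yd k
  exciting : PersistentlyExciting (T + (N + L + 1)) (n + (N + L + 1)) ud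

/-! ### Recorded data span all trajectory windows. -/

namespace IsExcitingRecord

variable {L₀ N L T : ℕ} {xd : ℕ → Fin n → ℝ} {ud : ℕ → Fin m → ℝ} {yd : ℕ → Fin p → ℝ}

theorem blockRow_state (h : S.IsExcitingRecord L₀ N L T xd ud yd) {i : ℕ} (hi : i < N + L + 1) :
    blockRow (T + 1) (i + 1) xd =
      S.A * blockRow (T + 1) i xd + S.B * blockRow (T + 1) i ud := by
  ext a j
  have := congrFun (h.satisfied (i + j) (by omega)).1 a
  rw [show i + (j : ℕ) + 1 = i + 1 + j by omega] at this
  exact this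

theorem blockRow_output (h : S.IsExcitingRecord L₀ N L T xd ud yd) {i : ℕ} (hi : i < N + L + 1) :
    blockRow (T + 1) i yd = S.C * blockRow (T + 1) i xd + S.D * blockRow (T + 1) i ud := by
  ext a j
  exact congrFun (h.satisfied (i + j) (by omega)).2 a

theorem satisfiedAt_combination (h : S.IsExcitingRecord L₀ N L T xd ud yd)
    (g : Fin (T + 1) → ℝ) {i : ℕ} (hi : i < N + L + 1) :
    S.SatisfiedAt (fun i => blockRow (T + 1) i xd *ᵥ g) (fun i => blockRow (T + 1) i ud *ᵥ g)
      (fun i => blockRow (T + 1) i yd *ᵥ g) i := by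
  constructor
  · simp only [h.blockRow_state hi, add_mulVec, mulVec_mulVec]
  · simp only [h.blockRow_output hi, add_mulVec, mulVec_mulVec]

/-- Every initial state with every input window is a combination of the recorded ones. -/
theorem exists_combination (h : S.IsExcitingRecord L₀ N L T xd ud yd) (x₀ : Fin n → ℝ)
    (w : ℕ → Fin m → ℝ) : ∃ g : Fin (T + 1) → ℝ, blockRow (T + 1) 0 xd *ᵥ g = x₀ ∧
      ∀ i < N + L + 1, blockRow (T + 1) i ud *ᵥ g = w i := by
  obtain ⟨g, hg⟩ := exists_mulVec_eq_of_vecMul_injective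
    (M := fromRows (blockRow (T + 1) 0 xd) (hankel (N + L + 1) (T + 1) ud)) (by
      intro v hv
      -- A left-kernel vector is an annihilator, padded by zero beyond the window; its vanishing
      -- makes the data matrix surjective.
      set η : ℕ → Fin m → ℝ := fun s b => if hs : s < N + L + 1 then v (.inr (⟨s, hs⟩, b)) else 0
        with hηdef
      obtain ⟨h1, h2⟩ := eq_zero_of_annihilates h.ctr (by omega) h.satisfied h.exciting
        (ξ := fun a => v (.inl a)) (η := η)
        (fun s hs => by ext b; simp only [hηdef, dif_neg hs.not_gt, Pi.zero_apply])
        (by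
          intro i hi
          have := congrFun hv ⟨i, by omega⟩
          simp only [vecMul, dotProduct, Fintype.sum_sum_type, fromRows_apply_inl,
            fromRows_apply_inr, Fintype.sum_prod_type, blockRow, hankel, of_apply, zero_add,
            Pi.zero_apply] at this
          rw [← this, Finset.sum_range]
          simp only [dotProduct, hηdef, Fin.is_lt, dite_true, Fin.eta, add_comm])
      ext (a | ⟨s, b⟩)
      · exact congrFun h1 a
      · have := congrFun (congrFun h2 s) b
        simpa only [hηdef, Fin.is_lt, dite_true, Fin.eta, Pi.zero_apply] using this)
    (Sum.elim x₀ fun i => w i.1 i.2)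
  refine ⟨g, ?_, ?_⟩
  · ext a
    exact congrFun hg (.inl a)
  · intro i hi
    ext b
    exact congrFun hg (.inr (⟨i, hi⟩, b))

theorem exists_combination_of_satisfiedAt (h : S.IsExcitingRecord L₀ N L T xd ud yd)
    {x : ℕ → Fin n → ℝ} {u : ℕ → Fin m → ℝ} {y : ℕ → Fin p → ℝ}
    (hs : ∀ k < N + L + 1, S.SatisfiedAt x u y k) :
    ∃ g : Fin (T + 1) → ℝ, ∀ i < N + L + 1,
      blockRow (T + 1) i ud *ᵥ g = u i ∧ blockRow (T + 1) i yd *ᵥ g = y i := by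
  obtain ⟨g, hx, hu⟩ := h.exists_combination (x 0) u
  refine ⟨g, fun i hi => ⟨hu i hi, ?_⟩⟩
  have hxi : ∀ i < N + L + 1, blockRow (T + 1) i xd *ᵥ g = x i := by
    intro i
    induction i with
    | zero => intro _; exact hx
    | succ i ih =>
      intro hi
      rw [(hs i (by omega)).1, ← ih (by omega), ← hu i (by omega)]
      exact (h.satisfiedAt_combination g (by omega)).1
  rw [(hs i hi).2, ← hxi i hi, ← hu i hi]
  exact (h.satisfiedAt_combination g hi).2

/-- Zero input and output over N ≥ n steps force the initial state to vanish, hence also the state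
at time N. The left inverse at time N then compares with the zero trajectory and needs only outputs
up to N + L₀ ≤ N + L. -/
theorem dataUf_mulVec_eq_zero (h : S.IsExcitingRecord L₀ N L T xd ud yd) {g : Fin (T + 1) → ℝ}
    (hY : dataY N L T yd *ᵥ g = 0) (hU : dataUp N T ud *ᵥ g = 0) : dataUf N T ud *ᵥ g = 0 := by
  rw [dataY, hankel_mulVec_eq_zero_iff] at hY
  rw [dataUp, hankel_mulVec_eq_zero_iff] at hU
  have hs := fun i hi => h.satisfiedAt_combination g (i := i) hi
  have hx0 : blockRow (T + 1) 0 xd *ᵥ g = 0 := by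
    refine LTISystem.eq_of_output_eq (S := S) (t := N) (x' := 0) (u := 0) (y := 0)
      (x := fun i => blockRow (T + 1) i xd *ᵥ g)
      (fun k hk => ?_) (fun k _ => SatisfiedAt.zero k) h.le_past h.obs
    have := hs k (by omega)
    simpa only [SatisfiedAt, hU k hk, hY k (show k < N + L + 1 by omega), Pi.zero_apply] using this
  have hxN := state_eq_zero_of_input_eq_zero (t := N)
    (fun k hk => hs k (by omega)) hU hx0 N le_rfl
  have h0 := h.inv (fun j => blockRow (T + 1) (N + j) xd *ᵥ g) 0
    (fun j => blockRow (T + 1) (N + j) ud *ᵥ g) 0 (fun j => blockRow (T + 1) (N + j) yd *ᵥ g) 0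
    (fun k hk => (hs (N + k) (by have := h.le_delay; omega)).shift)
    (fun k _ => SatisfiedAt.zero k) hxN
    (fun k hk => hY _ (by have := h.le_delay; omega))
  exact h0

end IsExcitingRecord

end LTISystem

/-- The complexification of a real matrix. -/
def Matrix.complexify {ι κ : Type*} (M : Matrix ι κ ℝ) : Matrix ι κ ℂ := M.map Complex.ofReal

/-! ### Complexification and zero directions. -/

section Complexify

variable {ι κ μ : Type*}

theorem Matrix.complexify_one [DecidableEq ι] : (1 : Matrix ι ι ℝ).complexify = 1 :=
  Matrix.map_one _ Complex.ofReal_zero Complex.ofReal_one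

theorem Matrix.complexify_add (M N : Matrix ι κ ℝ) :
    (M + N).complexify = M.complexify + N.complexify := by
  ext; simp [complexify]

theorem Matrix.complexify_zero : (0 : Matrix ι κ ℝ).complexify = 0 := by
  ext; simp [complexify]

variable [Fintype κ]

theorem Matrix.complexify_mul (M : Matrix ι κ ℝ) (N : Matrix κ μ ℝ) :
    (M * N).complexify = M.complexify * N.complexify :=
  Matrix.map_mul (f := Complex.ofRealHom)

theorem Matrix.complexify_mulVec_ofReal (M : Matrix ι κ ℝ) (v : κ → ℝ) :
    M.complexify *ᵥ (fun j => (v j : ℂ)) = fun i => ((M *ᵥ v) i : ℂ) := by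
  ext i
  simp [mulVec, dotProduct, complexify]

theorem Matrix.re_complexify_mulVec (M : Matrix ι κ ℝ) (v : κ → ℂ) (i : ι) :
    ((M.complexify *ᵥ v) i).re = (M *ᵥ fun j => (v j).re) i := by
  simp [mulVec, dotProduct, complexify]

theorem Matrix.im_complexify_mulVec (M : Matrix ι κ ℝ) (v : κ → ℂ) (i : ι) :
    ((M.complexify *ᵥ v) i).im = (M *ᵥ fun j => (v j).im) i := by
  simp [mulVec, dotProduct, complexify]

theorem Matrix.star_dotProduct_self_eq_sum_norm_sq (v : κ → ℂ) :
    star v ⬝ᵥ v = ((∑ j, ‖v j‖ ^ 2 : ℝ) : ℂ) := by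
  simp [dotProduct, Complex.conj_mul']

end Complexify

namespace LTISystem

variable {n m p : ℕ} {S : LTISystem n m p}

theorem IsObservable.eq_zero_complex (hS : S.IsObservable) {ξ : Fin n → ℂ}
    (hξ : ∀ k < n, (S.C * S.A ^ k).complexify *ᵥ ξ = 0) : ξ = 0 := by
  have h1 : (fun a => (ξ a).re) = 0 := hS.eq_zero fun k hk => by
    ext a
    rw [← re_complexify_mulVec, hξ k hk]; rfl
  have h2 : (fun a => (ξ a).im) = 0 := hS.eq_zero fun k hk => by
    ext a
    rw [← im_complexify_mulVec, hξ k hk]; rfl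
  ext a
  exact Complex.ext (congrFun h1 a) (congrFun h2 a)

/-- Complex observability along a state sequence with zero free response. -/
theorem IsObservable.eq_zero_of_free_response (hS : S.IsObservable) {ξ : ℕ → Fin n → ℂ} {t : ℕ}
    (ht : n ≤ t) (hA : ∀ i < t, ξ (i + 1) = S.A.complexify *ᵥ ξ i)
    (hC : ∀ i < t, S.C.complexify *ᵥ ξ i = 0) : ξ 0 = 0 := by
  refine hS.eq_zero_complex fun k hk => ?_
  have h1 : ∀ k ≤ t, ξ k = (S.A ^ k).complexify *ᵥ ξ 0 := by
    intro k
    induction k with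
    | zero => intro _; rw [pow_zero, complexify_one, one_mulVec]
    | succ k ih =>
      intro hk
      rw [hA k (by omega), ih (by omega), mulVec_mulVec, ← complexify_mul, pow_succ']
  rw [complexify_mul, ← mulVec_mulVec, ← h1 k (by omega), hC k (by omega)]

theorem isInvariantZero_iff {z : ℂ} : S.IsInvariantZero z ↔
    ∃ (ξ : Fin n → ℂ) (w : Fin m → ℂ), (ξ ≠ 0 ∨ w ≠ 0) ∧
      S.A.complexify *ᵥ ξ + S.B.complexify *ᵥ w = z • ξ ∧
      S.C.complexify *ᵥ ξ + S.D.complexify *ᵥ w = 0 := by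
  have hcard : n + m = Fintype.card (Fin n ⊕ Fin m) := by simp
  rw [IsInvariantZero, hcard, rank_lt_card_iff_exists_mulVec_eq_zero]
  have key : ∀ (ξ : Fin n → ℂ) (w : Fin m → ℂ),
      fromBlocks (S.A.map Complex.ofReal - z • (1 : Matrix (Fin n) (Fin n) ℂ))
        (S.B.map Complex.ofReal) (S.C.map Complex.ofReal) (S.D.map Complex.ofReal) *ᵥ
          Sum.elim ξ w = 0 ↔
      S.A.complexify *ᵥ ξ + S.B.complexify *ᵥ w = z • ξ ∧
      S.C.complexify *ᵥ ξ + S.D.complexify *ᵥ w = 0 := by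
    intro ξ w
    rw [fromBlocks_mulVec, ← Sum.elim_zero_zero, Sum.elim_eq_iff]
    simp only [Sum.elim_comp_inl, Sum.elim_comp_inr, sub_mulVec, smul_mulVec, one_mulVec]
    rw [sub_add_eq_add_sub, sub_eq_zero]
    rfl
  constructor
  · rintro ⟨v, hv, h⟩
    rw [← Sum.elim_comp_inl_inr v, key] at h
    refine ⟨v ∘ Sum.inl, v ∘ Sum.inr, ?_, h⟩
    by_contra! hc
    apply hv
    rw [← Sum.elim_comp_inl_inr v, hc.1, hc.2, Sum.elim_zero_zero]
  · rintro ⟨ξ, w, hne, h⟩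
    refine ⟨Sum.elim ξ w, ?_, (key ξ w).mpr h⟩
    intro h0
    rw [← Sum.elim_zero_zero, Sum.elim_eq_iff] at h0
    simp [h0.1, h0.2] at hne

/-- The zero direction of an invariant zero of an observable system has a nonzero input. -/
theorem IsInvariantZero.exists_direction (hobs : S.IsObservable) {z : ℂ}
    (hz : S.IsInvariantZero z) : ∃ (ξ : Fin n → ℂ) (w : Fin m → ℂ), w ≠ 0 ∧
      S.A.complexify *ᵥ ξ + S.B.complexify *ᵥ w = z • ξ ∧
      S.C.complexify *ᵥ ξ + S.D.complexify *ᵥ w = 0 := by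
  obtain ⟨ξ, w, hne, hA, hC⟩ := isInvariantZero_iff.mp hz
  refine ⟨ξ, w, ?_, hA, hC⟩
  rintro rfl
  rw [mulVec_zero, add_zero] at hA hC
  refine hne.elim (fun h => h ?_) (fun h => h rfl)
  -- With w = 0 the direction is an eigenvector of A in the kernel of C, excluded by observability.
  have := hobs.eq_zero_of_free_response (ξ := fun k => z ^ k • ξ) le_rfl
    (fun i _ => by rw [mulVec_smul, hA, smul_smul, pow_succ])
    (fun i _ => by rw [mulVec_smul, hC, smul_zero])
  simpa using this

/-- The real part of the exponential trajectory along a zero direction. -/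
theorem satisfiedAt_re_zero_direction {z : ℂ} {ξ : Fin n → ℂ} {w : Fin m → ℂ}
    (hA : S.A.complexify *ᵥ ξ + S.B.complexify *ᵥ w = z • ξ)
    (hC : S.C.complexify *ᵥ ξ + S.D.complexify *ᵥ w = 0) (k : ℕ) :
    S.SatisfiedAt (fun k a => (z ^ k * ξ a).re) (fun k a => (z ^ k * w a).re) 0 k := by
  constructor
  · ext a
    have h1 := congrArg (fun v => (z ^ k • v) a) hA
    simp only [smul_add, ← mulVec_smul, Pi.add_apply, smul_smul, ← pow_succ] at h1
    have h2 := congrArg Complex.re h1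
    rw [Complex.add_re, re_complexify_mulVec, re_complexify_mulVec] at h2
    exact h2.symm
  · ext a
    have h1 := congrArg (fun v => (z ^ k • v) a) hC
    simp only [smul_add, ← mulVec_smul, Pi.add_apply] at h1
    have h2 := congrArg Complex.re h1
    rw [Complex.add_re, re_complexify_mulVec, re_complexify_mulVec] at h2
    simpa using h2.symm

end LTISystem

/-! ### The companion map and the compressed shift. -/

section Companion

variable {N m : ℕ}

/-- The map advancing a window of length `N` by one step of the recursion
`e_{k+N} = M e_{k:k+N-1}`. -/
def companionMap (M : Matrix (Fin m) (Fin N × Fin m) ℂ) : Module.End ℂ (Fin N × Fin m → ℂ) where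
  toFun v i := if h : i.1 + 1 < N then v (⟨i.1 + 1, h⟩, i.2) else (M *ᵥ v) i.2
  map_add' v w := by
    ext i
    by_cases h : (i.1 : ℕ) + 1 < N <;> simp [h, mulVec_add]
  map_smul' c v := by
    ext i
    by_cases h : (i.1 : ℕ) + 1 < N <;> simp [h, mulVec_smul]

theorem companionMap_apply (M : Matrix (Fin m) (Fin N × Fin m) ℂ) (v : Fin N × Fin m → ℂ)
    (i : Fin N × Fin m) : companionMap M v i =
      if h : i.1 + 1 < N then v (⟨i.1 + 1, h⟩, i.2) else (M *ᵥ v) i.2 := rfl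

theorem companionMap_ext_apply {M : Matrix (Fin m) (Fin N × Fin m) ℂ} {v : ℕ → Fin m → ℂ}
    (hM : M *ᵥ (fun i : Fin N × Fin m => v i.1 i.2) = v N) :
    companionMap M (fun i => v i.1 i.2) = fun i => v (i.1 + 1) i.2 := by
  ext i
  rw [companionMap_apply]
  split_ifs with h
  · rfl
  · rw [hM, show (i.1 : ℕ) + 1 = N by have := i.1.2; omega]

/-- Compressing the window shift by an orthogonal projection leaves no eigenvalue outside the
open unit disc. -/
theorem eq_zero_of_compressed_shift_eigenvector {Q : Matrix (Fin N × Fin m) (Fin N × Fin m) ℝ}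
    (hQ : Qᵀ = Q) {r : Fin N × Fin m → ℂ} {z : ℂ} (hz : 1 ≤ ‖z‖) (hr : Q.complexify *ᵥ r = 0)
    (h : companionMap 0 r = Q.complexify *ᵥ companionMap 0 r + z • r) : r = 0 := by
  set R : ℕ → Fin m → ℂ := fun i a => if hi : i < N then r (⟨i, hi⟩, a) else 0 with hR
  set s := companionMap 0 r with hs
  set q := Q.complexify *ᵥ s with hq
  have hrR : ∀ i, r i = R i.1 i.2 := by
    intro i
    simp [hR]
  have hsR : ∀ i, s i = R (i.1 + 1) i.2 := by
    intro i
    simp only [hs, companionMap_apply, zero_mulVec, hR, Pi.zero_apply]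
  -- The shift drops the first block and appends zero, so it is a contraction.
  have hnorm : ∑ i, ‖s i‖ ^ 2 ≤ ∑ i, ‖r i‖ ^ 2 := by
    simp only [hsR, hrR, Fintype.sum_prod_type]
    rw [← Finset.sum_range (fun i => ∑ a, ‖R (i + 1) a‖ ^ 2),
      ← Finset.sum_range (fun i => ∑ a, ‖R i a‖ ^ 2)]
    have h1 := Finset.sum_range_succ (fun i => ∑ a, ‖R i a‖ ^ 2) N
    have h2 : ∑ a, ‖R N a‖ ^ 2 = 0 := Finset.sum_eq_zero fun a _ => by simp [hR]
    have h3 : 0 ≤ ∑ a, ‖R 0 a‖ ^ 2 := Finset.sum_nonneg fun a _ => by positivity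
    rw [Finset.sum_range_succ'] at h1
    linarith
  have hqr : star q ⬝ᵥ r = 0 := by
    have hQc : Q.complexifyᴴ = Q.complexify := by
      ext i j
      have := congrFun (congrFun hQ i) j
      simpa [complexify] using this
    rw [hq, star_mulVec, ← dotProduct_mulVec, hQc, hr, dotProduct_zero]
  have hrq : star r ⬝ᵥ q = 0 := by
    have := congrArg star hqr
    rwa [star_dotProduct, star_star, star_zero] at this
  -- Here q lies in the range of the symmetric Q and r in its kernel. With `hnorm` and |z| ≥ 1 this
  -- forces q = 0.
  have hpyth : ∑ i, ‖s i‖ ^ 2 = ∑ i, ‖q i‖ ^ 2 + ‖z‖ ^ 2 * ∑ i, ‖r i‖ ^ 2 := by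
    have h1 : star s ⬝ᵥ s = star q ⬝ᵥ q + (star z * z) * (star r ⬝ᵥ r) := by
      rw [h]
      simp only [star_add, star_smul, add_dotProduct, dotProduct_add, smul_dotProduct,
        dotProduct_smul, hqr, hrq, smul_eq_mul]
      ring
    rw [star_dotProduct_self_eq_sum_norm_sq, star_dotProduct_self_eq_sum_norm_sq,
      star_dotProduct_self_eq_sum_norm_sq, Complex.star_def, Complex.conj_mul'] at h1
    exact_mod_cast h1
  have hr0 : 0 ≤ ∑ i, ‖r i‖ ^ 2 := Finset.sum_nonneg fun a _ => by positivity
  have hz2 : 1 ≤ ‖z‖ ^ 2 := one_le_pow₀ hz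
  have hq0 : ∑ i, ‖q i‖ ^ 2 = 0 := by
    refine le_antisymm ?_ (Finset.sum_nonneg fun a _ => by positivity)
    nlinarith
  have hq1 : q = 0 := by
    ext i
    have := (Finset.sum_eq_zero_iff_of_nonneg fun a _ => by positivity).mp hq0 i (Finset.mem_univ i)
    simpa using this
  rw [hq1, zero_add] at h
  have hz0 : z ≠ 0 := by
    rintro rfl
    simp at hz
    linarith
  -- Now r is an eigenvector of a nilpotent shift with z ≠ 0; its blocks vanish from the last one
  -- backwards.
  have hstep : ∀ d ≤ N, R (N - d) = 0 := by
    intro d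
    induction d with
    | zero => intro _; ext a; simp [hR]
    | succ d ih =>
      intro hd
      ext a
      have h1 := congrFun h (⟨N - (d + 1), by omega⟩, a)
      rw [hsR, Pi.smul_apply, hrR] at h1
      simp only [show N - (d + 1) + 1 = N - d by omega, ih (by omega), Pi.zero_apply] at h1
      exact (smul_eq_zero.mp h1.symm).resolve_left hz0
  ext i
  rw [hrR, show (i.1 : ℕ) = N - (N - i.1) by have := i.1.2; omega, hstep _ (by omega)]
  rfl

end Companion

theorem dataY_mul_projY {p : ℕ} (N L T : ℕ) (yd : ℕ → Fin p → ℝ) :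
    dataY N L T yd * projY N L T yd = 0 := by
  rw [projY, Matrix.mul_sub, Matrix.mul_one, ← Matrix.mul_assoc, (pinv_spec _).mul_mul_self,
    sub_self]

theorem projY_mulVec_of_mem_ker {p N L T : ℕ} {yd : ℕ → Fin p → ℝ} {g : Fin (T + 1) → ℝ}
    (hg : dataY N L T yd *ᵥ g = 0) : projY N L T yd *ᵥ g = g := by
  rw [projY, sub_mulVec, one_mulVec, ← mulVec_mulVec, hg, mulVec_zero, sub_zero]

/-! ### Exactness of the estimator and spectrum of the error dynamics. -/

namespace LTISystem

variable {n m p : ℕ} {S : LTISystem n m p}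

namespace IsExcitingRecord

variable {L₀ N L T : ℕ} {xd : ℕ → Fin n → ℝ} {ud : ℕ → Fin m → ℝ} {yd : ℕ → Fin p → ℝ}

/-- On the input windows of the recorded zero-output trajectories the gain is the exact
one-step predictor. -/
theorem gainU_mul (h : S.IsExcitingRecord L₀ N L T xd ud yd) :
    gainU N L T ud yd * (dataUp N T ud * projY N L T yd) =
      dataUf N T ud * projY N L T yd := by
  set W := dataUp N T ud * projY N L T yd with hW
  have hY := dataY_mul_projY N L T yd
  -- The columns of Z lie in ker Y ∩ ker U_p because W W† W = W, hence in ker U_f.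
  set Z := projY N L T yd * (pinv W * W) - projY N L T yd with hZ
  have hUZ : dataUp N T ud * Z = 0 := by
    rw [hZ, Matrix.mul_sub, ← Matrix.mul_assoc, ← hW, ← Matrix.mul_assoc,
      (pinv_spec W).mul_mul_self, sub_self]
  have hYZ : dataY N L T yd * Z = 0 := by
    rw [hZ, Matrix.mul_sub, ← Matrix.mul_assoc, hY, Matrix.zero_mul, sub_zero]
  have hFZ : dataUf N T ud * Z = 0 := by
    refine ext_of_mulVec_single fun j => ?_
    rw [← mulVec_mulVec, zero_mulVec]
    apply h.dataUf_mulVec_eq_zero <;> rw [mulVec_mulVec]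
    · rw [hYZ, zero_mulVec]
    · rw [hUZ, zero_mulVec]
  rw [hZ, Matrix.mul_sub, sub_eq_zero] at hFZ
  rw [gainU, ← hW, Matrix.mul_assoc, Matrix.mul_assoc, hFZ]

theorem gainU_mul_add_gainY_mul (h : S.IsExcitingRecord L₀ N L T xd ud yd) :
    gainU N L T ud yd * dataUp N T ud + gainY N L T ud yd * dataY N L T yd = dataUf N T ud := by
  have h1 := h.gainU_mul
  have h2 : pinv (dataY N L T yd) * dataY N L T yd = 1 - projY N L T yd := by
    rw [projY, sub_sub_cancel]
  have h3 : gainY N L T ud yd * dataY N L T yd = dataUf N T ud * (1 - projY N L T yd) -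
      gainU N L T ud yd * dataUp N T ud * (1 - projY N L T yd) := by
    rw [← h2, gainY, gainU, Matrix.mul_sub, Matrix.sub_mul]
    simp only [Matrix.mul_assoc]
  rw [h3, Matrix.mul_sub, Matrix.mul_sub, Matrix.mul_one, Matrix.mul_one,
    Matrix.mul_assoc _ _ (projY N L T yd), h1]
  abel

/-- The estimator is exact on trajectories of the system. -/
theorem input_eq (h : S.IsExcitingRecord L₀ N L T xd ud yd)
    {x : ℕ → Fin n → ℝ} {u : ℕ → Fin m → ℝ} {y : ℕ → Fin p → ℝ}
    (hs : ∀ k, S.SatisfiedAt x u y k) (k : ℕ) :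
    u (k + N) = gainU N L T ud yd *ᵥ stack N u k + gainY N L T ud yd *ᵥ stack (N + L + 1) y k := by
  obtain ⟨g, hg⟩ := h.exists_combination_of_satisfiedAt
    (fun i _ => (hs (k + i)).shift)
  have h1 : dataUp N T ud *ᵥ g = stack N u k :=
    hankel_mulVec_eq_stack fun i hi => (hg i (by omega)).1
  have h2 : dataY N L T yd *ᵥ g = stack (N + L + 1) y k :=
    hankel_mulVec_eq_stack fun i hi => (hg i hi).2
  have h3 : dataUf N T ud *ᵥ g = u (k + N) := (hg N (by omega)).1
  rw [← h1, ← h2, ← h3, mulVec_mulVec, mulVec_mulVec, ← add_mulVec, h.gainU_mul_add_gainY_mul]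

theorem estimate_eq_of_satisfiedAt (h : S.IsExcitingRecord L₀ N L T xd ud yd)
    {x : ℕ → Fin n → ℝ} {u : ℕ → Fin m → ℝ} {y : ℕ → Fin p → ℝ}
    (hs : ∀ k, S.SatisfiedAt x u y k) (k : ℕ) :
    estimate N L T ud yd y (fun i => u i) k = u k := by
  induction k using Nat.strong_induction_on with
  | _ k ih =>
    by_cases hk : k < N
    · exact estimate_of_lt N L T ud yd y (fun i => u i) ⟨k, hk⟩
    · obtain ⟨j, rfl⟩ := Nat.exists_eq_add_of_le' (not_lt.mp hk)
      rw [estimate_add, h.input_eq hs]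
      congr 2
      ext ⟨i, a⟩
      exact congrFun (ih (j + i) (by have := i.2; omega)) a

theorem estimate_sub_add (h : S.IsExcitingRecord L₀ N L T xd ud yd)
    {x : ℕ → Fin n → ℝ} {u : ℕ → Fin m → ℝ} {y : ℕ → Fin p → ℝ}
    (hs : ∀ k, S.SatisfiedAt x u y k) (g : Fin N → Fin m → ℝ) (k : ℕ) :
    estimate N L T ud yd y g (k + N) - u (k + N) =
      gainU N L T ud yd *ᵥ stack N (fun i => estimate N L T ud yd y g i - u i) k := by
  rw [estimate_add, h.input_eq hs, add_sub_add_right_eq_sub, ← mulVec_sub]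
  rfl

/-- The input windows of the recorded zero-output trajectories, delayed by one step, are again
input windows of such trajectories. -/
theorem exists_shift_eq (h : S.IsExcitingRecord L₀ N L T xd ud yd) :
    ∃ K : Matrix (Fin (T + 1)) (Fin (T + 1)) ℝ, ∀ i < N,
      blockRow (T + 1) (i + 1) ud * projY N L T yd =
        blockRow (T + 1) i ud * (projY N L T yd * K) := by
  have key : ∀ g, ∃ g', ∀ i < N, blockRow (T + 1) (i + 1) ud *ᵥ (projY N L T yd *ᵥ g) =
      blockRow (T + 1) i ud *ᵥ (projY N L T yd *ᵥ g') := by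
    intro g
    set g₁ := projY N L T yd *ᵥ g with hg₁
    have hY : ∀ i < N + L + 1, blockRow (T + 1) i yd *ᵥ g₁ = 0 := by
      rw [← hankel_mulVec_eq_zero_iff, ← dataY, hg₁, mulVec_mulVec, dataY_mul_projY, zero_mulVec]
    -- Starting at time 1 leaves a window one step too short; it is prolonged from the same initial
    -- state, and the left inverse shows that its first N inputs are unchanged.
    have hs : ∀ i < N + L, S.SatisfiedAt (fun i => blockRow (T + 1) (1 + i) xd *ᵥ g₁)
        (fun i => blockRow (T + 1) (1 + i) ud *ᵥ g₁) 0 i := by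
      intro i hi
      have := (h.satisfiedAt_combination g₁ (i := 1 + i) (by omega)).shift
      simpa only [SatisfiedAt, hY (1 + i) (by omega), Pi.zero_apply] using this
    obtain ⟨x', u', hx', hs'⟩ :=
      exists_zeroOutput_extension (by have := h.le_past; omega) hs
    have hu := h.inv.eq_of_output_eq (fun k hk => hs' k (by omega)) hs hx'
    obtain ⟨g', hg'⟩ := h.exists_combination_of_satisfiedAt hs'
    refine ⟨g', fun i hi => ?_⟩
    have hY' : dataY N L T yd *ᵥ g' = 0 :=
      hankel_mulVec_eq_zero_iff.mpr fun i hi => (hg' i hi).2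
    rw [projY_mulVec_of_mem_ker hY', (hg' i (by omega)).1,
      (hu i (by have := h.le_delay; omega)).2, add_comm i 1]
  choose f hf using fun j : Fin (T + 1) => key (Pi.single j 1)
  refine ⟨Matrix.of fun i j => f j i, fun i hi => ?_⟩
  refine ext_of_mulVec_single fun j => ?_
  have h1 : (Matrix.of fun i j => f j i) *ᵥ Pi.single j 1 = f j := by
    ext a
    simp
  rw [← mulVec_mulVec, hf j i hi, ← mulVec_mulVec, ← mulVec_mulVec, h1]

theorem companionMap_mulVec (h : S.IsExcitingRecord L₀ N L T xd ud yd) (g : Fin (T + 1) → ℂ) :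
    companionMap (gainU N L T ud yd).complexify
        ((dataUp N T ud * projY N L T yd).complexify *ᵥ g) =
      fun i => ((blockRow (T + 1) (i.1 + 1) ud * projY N L T yd).complexify *ᵥ g) i.2 := by
  refine companionMap_ext_apply
    (v := fun i => (blockRow (T + 1) i ud * projY N L T yd).complexify *ᵥ g) ?_
  change _ *ᵥ ((dataUp N T ud * projY N L T yd).complexify *ᵥ g) = _
  rw [mulVec_mulVec, ← complexify_mul, h.gainU_mul]
  rfl

theorem exists_companionMap_mulVec_eq (h : S.IsExcitingRecord L₀ N L T xd ud yd) :
    ∃ K : Matrix (Fin (T + 1)) (Fin (T + 1)) ℂ, ∀ g,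
      companionMap (gainU N L T ud yd).complexify
          ((dataUp N T ud * projY N L T yd).complexify *ᵥ g) =
        (dataUp N T ud * projY N L T yd).complexify *ᵥ (K *ᵥ g) := by
  obtain ⟨K, hK⟩ := h.exists_shift_eq
  refine ⟨K.complexify, fun g => ?_⟩
  rw [h.companionMap_mulVec, mulVec_mulVec, ← complexify_mul, Matrix.mul_assoc]
  ext ⟨i, a⟩
  simp only [hK i i.2]
  rfl

/-- Eigenvectors of the error dynamics among the input windows of zero-output trajectories
belong to invariant zeros. -/
theorem isInvariantZero_of_eigenvector (h : S.IsExcitingRecord L₀ N L T xd ud yd) {z : ℂ}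
    {g : Fin (T + 1) → ℂ} (hne : (dataUp N T ud * projY N L T yd).complexify *ᵥ g ≠ 0)
    (hz : companionMap (gainU N L T ud yd).complexify
        ((dataUp N T ud * projY N L T yd).complexify *ᵥ g) =
      z • ((dataUp N T ud * projY N L T yd).complexify *ᵥ g)) : S.IsInvariantZero z := by
  rw [h.companionMap_mulVec] at hz
  set g₁ := (projY N L T yd).complexify *ᵥ g with hg₁
  set U : ℕ → Fin m → ℂ := fun i => (blockRow (T + 1) i ud).complexify *ᵥ g₁ with hU
  set X : ℕ → Fin n → ℂ := fun i => (blockRow (T + 1) i xd).complexify *ᵥ g₁ with hX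
  have hUz : ∀ i < N, U (i + 1) = z • U i := by
    intro i hi
    ext a
    have := congrFun hz (⟨i, hi⟩, a)
    simp only [complexify_mul, ← mulVec_mulVec] at this
    exact this
  have hXs : ∀ i < N + L + 1, X (i + 1) = S.A.complexify *ᵥ X i + S.B.complexify *ᵥ U i := by
    intro i hi
    simp only [hX, hU, h.blockRow_state hi, complexify_add, complexify_mul, add_mulVec,
      mulVec_mulVec]
  have hYs : ∀ i < N + L + 1, S.C.complexify *ᵥ X i + S.D.complexify *ᵥ U i = 0 := by
    intro i hi
    have h1 : blockRow (T + 1) i yd * projY N L T yd = 0 := by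
      ext a j
      exact congrFun (congrFun (dataY_mul_projY N L T yd) (⟨i, hi⟩, a)) j
    have h2 : (blockRow (T + 1) i yd).complexify *ᵥ g₁ = 0 := by
      rw [hg₁, mulVec_mulVec, ← complexify_mul, h1, complexify_zero, zero_mulVec]
    rw [← h2, h.blockRow_output hi]
    simp only [hX, hU, complexify_add, complexify_mul, add_mulVec, mulVec_mulVec]
  -- In X (i+1) − z X i the inputs cancel, leaving a free response with zero output over N ≥ n
  -- steps.
  have hξ : X 1 - z • X 0 = 0 := by
    refine h.obs.eq_zero_of_free_response (ξ := fun i => X (i + 1) - z • X i) (t := N) h.le_past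
      (fun i hi => ?_) (fun i hi => ?_)
    · have h1 := congrArg (fun v => z • v) (hXs i (by omega))
      simp only [smul_add] at h1
      rw [hXs (i + 1) (by omega), hUz i hi, mulVec_sub, mulVec_smul, mulVec_smul, h1]
      abel
    · have h1 := hYs (i + 1) (by omega)
      have h2 := congrArg (fun v => z • v) (hYs i (by omega))
      simp only [smul_add, smul_zero, ← mulVec_smul] at h2
      rw [hUz i hi] at h1
      rw [mulVec_sub, sub_eq_zero]
      exact add_right_cancel (h1.trans h2.symm)
  refine isInvariantZero_iff.mpr ⟨X 0, U 0, Or.inr fun h0 => hne ?_, ?_, hYs 0 (by omega)⟩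
  · have hU0 : ∀ i < N, U i = 0 := by
      intro i
      induction i with
      | zero => intro _; exact h0
      | succ i ih => intro hi; rw [hUz i (by omega), ih (by omega), smul_zero]
    rw [complexify_mul, ← mulVec_mulVec]
    ext ⟨i, a⟩
    exact congrFun (hU0 i i.2) a
  · rw [← hXs 0 (by omega), zero_add, ← sub_eq_zero, hξ]

theorem dataUp_mul_projY_eq_zero (h : S.IsExcitingRecord L₀ N L T xd ud yd)
    (hz : ∀ z, ¬ S.IsInvariantZero z) : dataUp N T ud * projY N L T yd = 0 := by
  obtain ⟨K, hK⟩ := h.exists_companionMap_mulVec_eq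
  set W := dataUp N T ud * projY N L T yd with hW
  set R := LinearMap.range W.complexify.mulVecLin with hR
  have hmaps : ∀ v ∈ R, companionMap (gainU N L T ud yd).complexify v ∈ R := by
    rintro _ ⟨g, rfl⟩
    exact ⟨K *ᵥ g, (hK g).symm⟩
  by_contra hne
  have : Nontrivial R := by
    rw [Submodule.nontrivial_iff_ne_bot]
    intro hbot
    rw [hR, LinearMap.range_eq_bot] at hbot
    apply hne
    ext i j
    have h1 := congrFun (LinearMap.congr_fun hbot (Pi.single j 1)) i
    simpa [complexify] using h1
  obtain ⟨z, hev⟩ := Module.End.exists_eigenvalue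
    ((companionMap (gainU N L T ud yd).complexify).restrict hmaps)
  obtain ⟨⟨_, ⟨g, rfl⟩⟩, hv⟩ := hev.exists_hasEigenvector
  refine hz z (h.isInvariantZero_of_eigenvector (g := g) ?_ ?_)
  · intro h0
    exact hv.2 (Subtype.ext h0)
  · exact congrArg Subtype.val hv.apply_eq_smul

theorem gainU_eq_zero (h : S.IsExcitingRecord L₀ N L T xd ud yd)
    (hz : ∀ z, ¬ S.IsInvariantZero z) : gainU N L T ud yd = 0 := by
  have h1 : pinv (0 : Matrix (Fin N × Fin m) (Fin (T + 1)) ℝ) = 0 := by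
    rw [← (pinv_spec _).mul_mul_inv, Matrix.mul_zero, Matrix.zero_mul]
  rw [gainU, h.dataUp_mul_projY_eq_zero hz, h1, Matrix.mul_zero]

/-- Eigenvalues of the error dynamics outside the open unit disc are invariant zeros. -/
theorem isInvariantZero_of_hasEigenvalue (h : S.IsExcitingRecord L₀ N L T xd ud yd) {z : ℂ}
    (hev : (companionMap (gainU N L T ud yd).complexify).HasEigenvalue z) (hz : 1 ≤ ‖z‖) :
    S.IsInvariantZero z := by
  obtain ⟨v, hv⟩ := hev.exists_hasEigenvector
  obtain ⟨K, hK⟩ := h.exists_companionMap_mulVec_eq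
  have hΦ := hv.apply_eq_smul
  have hv0 := hv.2
  set W := dataUp N T ud * projY N L T yd with hW
  set Φ := companionMap (gainU N L T ud yd).complexify with hΦdef
  set Q := W * pinv W with hQ
  have hQW : Q * W = W := (pinv_spec W).mul_mul_self
  have hQQ : Q * Q = Q := by rw [hQ, ← Matrix.mul_assoc, hQW]
  have hMQ : gainU N L T ud yd * Q = gainU N L T ud yd := by
    have := (pinv_spec W).mul_mul_inv
    rw [Matrix.mul_assoc] at this
    rw [gainU, ← hW, Matrix.mul_assoc, hQ, this]
  set r := v - Q.complexify *ᵥ v with hr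
  have hQr : Q.complexify *ᵥ r = 0 := by
    rw [hr, mulVec_sub, mulVec_mulVec, ← complexify_mul, hQQ, sub_self]
  have hMr : (gainU N L T ud yd).complexify *ᵥ r = 0 := by
    rw [hr, mulVec_sub, mulVec_mulVec, ← complexify_mul, hMQ, sub_self]
  have hΦr : companionMap 0 r = Φ r := by
    ext i
    simp only [hΦdef, companionMap_apply, zero_mulVec, hMr]
  have hQv : Q.complexify *ᵥ v = W.complexify *ᵥ ((pinv W).complexify *ᵥ v) := by
    rw [mulVec_mulVec, ← complexify_mul]
  -- Φ preserves the range of W, on which Q is the identity.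
  have hΦQ : Q.complexify *ᵥ Φ (Q.complexify *ᵥ v) = Φ (Q.complexify *ᵥ v) := by
    rw [hQv, hK, mulVec_mulVec, ← complexify_mul, hQW]
  have hr0 : r = 0 := by
    refine eq_zero_of_compressed_shift_eigenvector (pinv_spec W).symm_left hz hQr ?_
    rw [hΦr, hr, map_sub, mulVec_sub, hΦQ, hΦ, mulVec_smul, smul_sub]
    abel
  rw [hr, sub_eq_zero, hQv] at hr0
  refine h.isInvariantZero_of_eigenvector (g := (pinv W).complexify *ᵥ v) ?_ ?_
  · rw [← hW, ← hr0]; exact hv0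
  · rw [← hW, ← hr0]; exact hΦ

theorem tendsto_estimate_sub (h : S.IsExcitingRecord L₀ N L T xd ud yd)
    {x : ℕ → Fin n → ℝ} {u : ℕ → Fin m → ℝ} {y : ℕ → Fin p → ℝ}
    (hs : ∀ k, S.SatisfiedAt x u y k) (hz : ∀ z, S.IsInvariantZero z → ‖z‖ < 1)
    (g : Fin N → Fin m → ℝ) :
    Tendsto (fun k => estimate N L T ud yd y g k - u k) atTop (𝓝 0) := by
  set e := fun k => estimate N L T ud yd y g k - u k with he
  have hrec : ∀ k, e (k + N) = gainU N L T ud yd *ᵥ stack N e k := h.estimate_sub_add hs g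
  set Φ := companionMap (gainU N L T ud yd).complexify with hΦ
  have hE : ∀ k, (fun i => ((stack N e k i : ℝ) : ℂ)) =
      (Φ ^ k) (fun i => ((stack N e 0 i : ℝ) : ℂ)) := by
    intro k
    induction k with
    | zero => rfl
    | succ k ih =>
      rw [pow_succ', Module.End.mul_apply, ← ih]
      have := companionMap_ext_apply (M := (gainU N L T ud yd).complexify)
        (v := fun i a => ((e (k + i) a : ℝ) : ℂ)) (by
          change _ *ᵥ (fun i => ((stack N e k i : ℝ) : ℂ)) = _
          rw [complexify_mulVec_ofReal, hrec])
      refine Eq.trans ?_ this.symm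
      ext i
      simp only [stack, show k + 1 + (i.1 : ℕ) = k + (i.1 + 1) by omega]
  have hlim := Module.End.tendsto_pow_apply_of_hasEigenvalue_norm_lt_one Φ
    (fun z hev => by
      by_contra hc
      exact hc (hz z (h.isInvariantZero_of_hasEigenvalue hev (not_lt.mp hc))))
    (fun i => ((stack N e 0 i : ℝ) : ℂ))
  simp only [← hE] at hlim
  have hstack : Tendsto (fun k => stack N e k) atTop (𝓝 0) := by
    rw [tendsto_pi_nhds] at hlim ⊢
    intro i
    exact (Complex.continuous_re.tendsto _).comp (hlim i)
  have hcont : Continuous fun v => gainU N L T ud yd *ᵥ v := by fun_prop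
  have := (hcont.tendsto 0).comp hstack
  rw [mulVec_zero] at this
  rw [← tendsto_add_atTop_iff_nat N]
  exact this.congr fun k => (hrec k).symm

theorem norm_lt_one_of_tendsto (h : S.IsExcitingRecord L₀ N L T xd ud yd)
    {x : ℕ → Fin n → ℝ} {u : ℕ → Fin m → ℝ} {y : ℕ → Fin p → ℝ}
    (hs : ∀ k, S.SatisfiedAt x u y k)
    (hlim : ∀ g : Fin N → Fin m → ℝ,
      Tendsto (fun k => estimate N L T ud yd y g k - u k) atTop (𝓝 0))
    {z : ℂ} (hz : S.IsInvariantZero z) : ‖z‖ < 1 := by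
  obtain ⟨ξ, w, hw, hA, hC⟩ := hz.exists_direction h.obs
  have hre : ∀ (ξ : Fin n → ℂ) (w : Fin m → ℂ),
      S.A.complexify *ᵥ ξ + S.B.complexify *ᵥ w = z • ξ →
      S.C.complexify *ᵥ ξ + S.D.complexify *ᵥ w = 0 → ∀ a,
      Tendsto (fun k : ℕ => (z ^ k * w a).re) atTop (𝓝 0) := by
    intro ξ w hA hC a
    -- The added zero-output trajectory leaves y unchanged, so the estimate started from the sum
    -- equals the sum and its error is exactly `e`.
    have hs' := fun k => (hs k).add (satisfiedAt_re_zero_direction hA hC k)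
    rw [add_zero] at hs'
    set e : ℕ → Fin m → ℝ := fun k a => (z ^ k * w a).re
    refine (tendsto_pi_nhds.mp (hlim fun i => (u + e) i) a).congr fun k => ?_
    rw [h.estimate_eq_of_satisfiedAt hs', Pi.add_apply, add_sub_cancel_left]
  obtain ⟨a, ha⟩ : ∃ a, w a ≠ 0 := Function.ne_iff.mp hw
  have h1 := hre ξ w hA hC a
  -- Rotating the direction by i supplies the imaginary part of z^k w.
  have h2 := hre (Complex.I • ξ) (Complex.I • w)
    (by rw [mulVec_smul, mulVec_smul, ← smul_add, hA, smul_comm])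
    (by rw [mulVec_smul, mulVec_smul, ← smul_add, hC, smul_zero]) a
  have h3 : Tendsto (fun k : ℕ => z ^ k * w a) atTop (𝓝 0) := by
    have h4 := ((Complex.continuous_ofReal.tendsto _).comp h1).sub
      (((Complex.continuous_ofReal.tendsto _).comp h2).mul_const Complex.I)
    simp only [Complex.ofReal_zero, zero_mul, sub_zero] at h4
    refine h4.congr fun k => ?_
    apply Complex.ext <;> simp [Complex.mul_re, Complex.mul_im]
    ring
  by_contra! hc
  have h4 := h3.norm
  rw [norm_zero] at h4
  have h5 : ‖w a‖ ≤ 0 := ge_of_tendsto' h4 fun k => by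
    rw [norm_mul, norm_pow]
    exact le_mul_of_one_le_left (norm_nonneg _) (one_le_pow₀ hc)
  exact ha (norm_le_zero_iff.mp h5)

end IsExcitingRecord

end LTISystem

end

theorem corollary1 {n m p : ℕ} (S : LTISystem n m p)
    (hobs : S.IsObservable) (hctr : S.IsControllable)
    (L₀ : ℕ) (hL₀ : L₀ ≤ n) (hinv : S.HasDelayLeftInverse L₀)
    (N L T : ℕ) (hN : n ≤ N) (hL : L₀ ≤ L)
    -- offline data: a recorded trajectory of length `T + N + L + 1`
    (xd : ℕ → Fin n → ℝ) (ud : ℕ → Fin m → ℝ) (yd : ℕ → Fin p → ℝ)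
    (hd : ∀ k < T + N + L + 1, S.SatisfiedAt xd ud yd k)
    (hPE : PersistentlyExciting (T + N + L + 1) (n + N + L + 1) ud)
    -- online data: the trajectory whose input is to be reconstructed
    (x : ℕ → Fin n → ℝ) (u : ℕ → Fin m → ℝ) (y : ℕ → Fin p → ℝ)
    (h : ∀ k, S.SatisfiedAt x u y k) :
    ((∀ z : ℂ, ¬ S.IsInvariantZero z) →
      gainU N L T ud yd = 0 ∧
      ∀ g : Fin N → Fin m → ℝ, ∀ k ≥ N, estimate N L T ud yd y g k = u k) ∧
    ((∀ g : Fin N → Fin m → ℝ,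
        Tendsto (fun k => estimate N L T ud yd y g k - u k) atTop (𝓝 0)) ↔
      ∀ z : ℂ, S.IsInvariantZero z → ‖z‖ < 1) := by
  have hR : S.IsExcitingRecord L₀ N L T xd ud yd :=
    ⟨hobs, hctr, hinv, hN, hL, fun k hk => hd k (by omega), by simpa only [← add_assoc] using hPE⟩
  refine ⟨fun hz => ?_, fun hlim z hz => hR.norm_lt_one_of_tendsto h hlim hz,
    fun hz g => hR.tendsto_estimate_sub h hz g⟩
  have h0 := hR.gainU_eq_zero hz
  refine ⟨h0, fun g k hk => ?_⟩
  obtain ⟨j, rfl⟩ := Nat.exists_eq_add_of_le' hk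
  rw [← sub_eq_zero, hR.estimate_sub_add h, h0, zero_mulVec]
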